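/- Let $N\ge 2$ be an integer, $\omega=e^{i\pi/N}$, and let $\mathcal G_N=\langle \omega I, X, \mathrm{diag}(1,\omega^2)\rangle$ be the one-qubit XP group of precision $N$, where $X=\begin{pmatrix}0&1\\1&0\end{pmatrix}$; the $n$-qubit XP group $\mathcal G_N^{n}$ consists of all tensor products $g_1\otimes\cdots\otimes g_n$ with $g_i\in\mathcal G_N$. An $n$-qubit XP stabilizer state of precision $N$ is a unit vector $|\psi\rangle\in(\mathbb C^2)^{\otimes n}$ for which there is a subgroup $\mathcal S\le\mathcal G_N^{n}$ such that the space $\{|\phi\rangle : g|\phi\rangle=|\phi\rangle \text{ for all } g\in\mathcal S\}$ is one-dimensional and spanned by $|\psi\rangle$. Consider the following atomic tensors (Legos), given by their components in the computational basis: the two-leg tensors of the phase gate $\mathrm{diag}(1,e^{i\pi/N})$ and of the Hadamard gate $H=\tfrac1{\sqrt2}\begin{pmatrix}1&1\\1&-1\end{pmatrix}$, the one-leg tensor of the state $|0\rangle$, and the three-leg tensor of the encoding map $|00\rangle\langle 0|+|11\rangle\langle 1|$ of the two-qubit repetition code. Tracing two distinct legs $j,k$ of a tensor $V$ means replacing $V$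 by $\sum_{i_j,i_k}V_{i_1,\dots,i_m}\,\delta_{i_j,i_k}$. Theorem. For every $N\ge2$ and every $n$, every $n$-qubit XP stabilizer state $|\psi\rangle$ of precision $N$ can be produced exactly from finitely many copies of these atomic tensors by taking tensor products, permuting legs and tracing pairs of legs: there is a complex number $c$ with $|c|=1$ (a global phase) such that $c\,|\psi\rangle$ is the tensor obtained. -/

import Mathlib

open Matrix

noncomputable section

namespace XPLego

/-! ### The XP group of precision `N` -/

/-- The root of unity `ω = exp(iπ/N)`. -/
def omega (N : ℕ) : ℂ := Complex.exp (Complex.I * Real.pi / N)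

/-- The bit flip `X`. -/
def matX : Matrix (Fin 2) (Fin 2) ℂ := !![0, 1; 1, 0]

/-- The phase operator `diag(1, ω²)` that enters the XP group of precision `N`. -/
def matP (N : ℕ) : Matrix (Fin 2) (Fin 2) ℂ := !![1, 0; 0, omega N ^ 2]

theorem star_omega_mul (N : ℕ) : star (omega N) * omega N = 1 := by
  have h : star (omega N) = (omega N)⁻¹ := by
    rw [omega, ← Complex.exp_neg, Complex.star_def, ← Complex.exp_conj]
    congr 1
    simp [neg_div]
  rw [h, inv_mul_cancel₀]
  exact Complex.exp_ne_zero _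

theorem scalar_mem (N : ℕ) :
    omega N • (1 : Matrix (Fin 2) (Fin 2) ℂ) ∈ unitaryGroup (Fin 2) ℂ := by
  rw [mem_unitaryGroup_iff']
  have h := star_omega_mul N
  rw [star_smul, star_one, smul_mul_smul_comm, h, one_smul, one_mul]

theorem matX_mem : matX ∈ unitaryGroup (Fin 2) ℂ := by
  rw [mem_unitaryGroup_iff']
  ext i j
  fin_cases i <;> fin_cases j <;> simp [matX, Matrix.mul_apply, Fin.sum_univ_two]

theorem matP_mem (N : ℕ) : matP N ∈ unitaryGroup (Fin 2) ℂ := by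
  rw [mem_unitaryGroup_iff']
  have h : star (omega N) ^ 2 * omega N ^ 2 = 1 := by
    rw [← mul_pow, star_omega_mul, one_pow]
  simp only [Complex.star_def] at h
  ext i j
  fin_cases i <;> fin_cases j <;> simp [matP, Matrix.mul_apply, Fin.sum_univ_two, h]

/-- The one-qubit XP group `⟨ω I, X, P⟩` of precision `N`. -/
def xpGroupOne (N : ℕ) : Subgroup (unitaryGroup (Fin 2) ℂ) :=
  Subgroup.closure {⟨omega N • 1, scalar_mem N⟩, ⟨matX, matX_mem⟩, ⟨matP N, matP_mem N⟩}

/-- The tensor product `A₀ ⊗ ⋯ ⊗ Aₙ₋₁` of one-qubit operators, as a matrix on the computational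
basis, which is indexed by bit strings of length `n`. -/
def tensorMat {n : ℕ} (A : Fin n → Matrix (Fin 2) (Fin 2) ℂ) :
    Matrix (Fin n → Fin 2) (Fin n → Fin 2) ℂ :=
  Matrix.of fun a b => ∏ i, A i (a i) (b i)

theorem tensorMat_one {n : ℕ} : tensorMat (fun _ : Fin n => 1) = 1 := by
  ext a b
  by_cases h : a = b
  · subst h
    simp [tensorMat]
  · obtain ⟨i, hi⟩ := Function.ne_iff.mp h
    rw [Matrix.one_apply_ne h]
    exact Finset.prod_eq_zero (Finset.mem_univ i) (Matrix.one_apply_ne hi)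

theorem tensorMat_mul {n : ℕ} (A B : Fin n → Matrix (Fin 2) (Fin 2) ℂ) :
    tensorMat (fun i => A i * B i) = tensorMat A * tensorMat B := by
  ext a b
  simp only [tensorMat, Matrix.of_apply, Matrix.mul_apply, ← Finset.prod_mul_distrib]
  exact Fintype.prod_sum fun i c => A i (a i) c * B i c (b i)

theorem tensorMat_star {n : ℕ} (A : Fin n → Matrix (Fin 2) (Fin 2) ℂ) :
    star (tensorMat A) = tensorMat fun i => star (A i) := by
  ext a b
  simp [tensorMat, Matrix.star_apply]

theorem tensorMat_mem {n : ℕ} (g : Fin n → unitaryGroup (Fin 2) ℂ) :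
    tensorMat (fun i => (g i : Matrix (Fin 2) (Fin 2) ℂ)) ∈ unitaryGroup (Fin n → Fin 2) ℂ := by
  rw [mem_unitaryGroup_iff', tensorMat_star, ← tensorMat_mul]
  simp only [UnitaryGroup.star_mul_self]
  exact tensorMat_one

/-- The tensor product of `n` one-qubit unitaries, as a group homomorphism. -/
def tensorHom (n : ℕ) :
    (Fin n → unitaryGroup (Fin 2) ℂ) →* unitaryGroup (Fin n → Fin 2) ℂ where
  toFun g := ⟨tensorMat fun i => (g i : Matrix (Fin 2) (Fin 2) ℂ), tensorMat_mem g⟩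
  map_one' := Subtype.ext tensorMat_one
  map_mul' g h := Subtype.ext <|
    tensorMat_mul (fun i => (g i : Matrix (Fin 2) (Fin 2) ℂ))
      (fun i => (h i : Matrix (Fin 2) (Fin 2) ℂ))

/-- The XP group of precision `N` on `n` qubits: all tensor products of `n` elements of the
one-qubit XP group. -/
def xpGroup (N n : ℕ) : Subgroup (unitaryGroup (Fin n → Fin 2) ℂ) :=
  (Subgroup.pi Set.univ fun _ : Fin n => xpGroupOne N).map (tensorHom n)

/-! ### XP stabilizer states -/

/-- The subspace of vectors fixed by every element of `S`. -/
def codespace {n : ℕ} (S : Subgroup (unitaryGroup (Fin n → Fin 2) ℂ)) :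
    Submodule ℂ ((Fin n → Fin 2) → ℂ) where
  carrier := {ψ | ∀ g ∈ S, (g : Matrix (Fin n → Fin 2) (Fin n → Fin 2) ℂ) *ᵥ ψ = ψ}
  zero_mem' := fun _ _ => Matrix.mulVec_zero _
  add_mem' := fun ha hb g hg => by rw [Matrix.mulVec_add, ha g hg, hb g hg]
  smul_mem' := fun c _ ha g hg => by rw [Matrix.mulVec_smul, ha g hg]

/-- `ψ` is an `n`-qubit XP stabilizer state of precision `N`: a unit vector that spans the
(one-dimensional) codespace of some subgroup of the XP group of precision `N`. -/
def IsXPState (N : ℕ) {n : ℕ} (ψ : (Fin n → Fin 2) → ℂ) : Prop :=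
  ∑ e, ‖ψ e‖ ^ 2 = 1 ∧
    ∃ S : Subgroup (unitaryGroup (Fin n → Fin 2) ℂ),
      S ≤ xpGroup N n ∧ codespace S = Submodule.span ℂ {ψ}

/-! ### Tensors and tracing -/

/-- A tensor with qubit legs labelled by `ι`, given by its components. -/
abbrev Tensor (ι : Type) : Type := (ι → Fin 2) → ℂ

/-- The two-leg tensor of components `⟨i|A|j⟩` of a one-qubit operator `A`. -/
def opTensor (A : Matrix (Fin 2) (Fin 2) ℂ) : Tensor (Fin 2) := fun i => A (i 0) (i 1)

/-- The phase gate `diag(1, exp(iπ/N))`, that is `diag(1, ω)`. -/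
def phaseGate (N : ℕ) : Matrix (Fin 2) (Fin 2) ℂ := !![1, 0; 0, omega N]

/-- The Hadamard gate. -/
def hadamard : Matrix (Fin 2) (Fin 2) ℂ :=
  ((Real.sqrt 2 : ℝ) : ℂ)⁻¹ • !![1, 1; 1, -1]

/-- The one-leg tensor of the state `|0⟩`. -/
def ketZero : Tensor (Fin 1) := fun i => if i 0 = 0 then 1 else 0

/-- The three-leg tensor of the encoding map `|00⟩⟨0| + |11⟩⟨1|` of the two-qubit repetition
code. -/
def repetition : Tensor (Fin 3) := fun i => if i 0 = i 1 ∧ i 1 = i 2 then 1 else 0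

/-- The tensor product of two tensors: they are placed side by side. -/
def Tensor.prod {ι κ : Type} (V : Tensor ι) (W : Tensor κ) : Tensor (ι ⊕ κ) :=
  fun i => V (fun l => i (Sum.inl l)) * W (fun l => i (Sum.inr l))

/-- Renaming (in particular, reordering) of legs. -/
def Tensor.relabel {ι κ : Type} (f : ι ≃ κ) (V : Tensor ι) : Tensor κ :=
  fun i => V fun l => i (f l)

open Classical in
/-- The assignment of bits to all legs that is `a` on leg `j`, `b` on leg `k` and `i` on the
other ones. -/
def fillLegs {ι : Type} (j k : ι) (a b : Fin 2) (i : {l : ι // l ≠ j ∧ l ≠ k} → Fin 2) :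
    ι → Fin 2 :=
  fun l => if h : l ≠ j ∧ l ≠ k then i ⟨l, h⟩ else if l = j then a else b

/-- Tracing (contraction) of the legs `j` and `k`: the tensor
`∑_{a, b} V_{… a … b …} δ_{a b}` on the remaining legs. -/
def Tensor.trace {ι : Type} (j k : ι) (V : Tensor ι) : Tensor {l : ι // l ≠ j ∧ l ≠ k} :=
  fun i => ∑ a : Fin 2, ∑ b : Fin 2, V (fillLegs j k a b i) * (if a = b then 1 else 0)

/-- The tensors that can be produced by tracing together finitely many copies of the atomic
Legos: the phase gate `diag(1, exp(iπ/N))`, the Hadamard gate, the state `|0⟩` and the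
encoding tensor of the two-qubit repetition code. -/
inductive Producible (N : ℕ) : (ι : Type) → Tensor ι → Prop
  | phase : Producible N (Fin 2) (opTensor (phaseGate N))
  | hadamard : Producible N (Fin 2) (opTensor hadamard)
  | ketZero : Producible N (Fin 1) ketZero
  | repetition : Producible N (Fin 3) repetition
  | prod {ι κ : Type} {V : Tensor ι} {W : Tensor κ} :
      Producible N ι V → Producible N κ W → Producible N (ι ⊕ κ) (V.prod W)
  | relabel {ι κ : Type} (f : ι ≃ κ) {V : Tensor ι} :
      Producible N ι V → Producible N κ (V.relabel f)
  | trace {ι : Type} (j k : ι) (hjk : j ≠ k) {V : Tensor ι} :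
      Producible N ι V → Producible N {l : ι // l ≠ j ∧ l ≠ k} (V.trace j k)

end XPLego

end

/-! Every element of the XP group is monomial: it shifts bit strings by some `x` and multiplies by
phases `ω ^ (p i + 2 * z i * v i)`. Let `L` be the `𝔽₂`-span of the shifts occurring in `S`, and let
`ψ a ≠ 0`. Truncating `ψ` to the coset `a + L` gives another fixed vector, so one-dimensionality
forces `ψ` to vanish off `a + L`; on the coset the amplitudes differ only by phases
(`IsXPState.exists_eq`). Adjoining the generators of `L` one at a time creates phases quadratic in
the bits, but always with an even coefficient, and `2xy = x + y - (x ⊕ y)` turns these into products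
of powers of `ω ^ χ` with `χ` affine (`exists_phase`). On the tensor side, the repetition tensor
copies legs, so producible tensors are closed under pointwise products, and Hadamards implement the
Fourier transform on `ZMod 2`, so a one-leg tensor can be composed with any affine function
(`comp_affine`). This yields both the phases and the indicator of `a + L`. Normalization makes `‖ψ
a‖` a power of `1/√2`, itself a producible scalar. -/

namespace XPLego

/-! ### Closure properties of producible tensors -/

namespace Producible

variable {N : ℕ} {ι κ : Type}

/-- Tracing the legs `j` and `k`, where `p` names the remaining legs and `g a i` is the assignment
that is `a` on the traced legs and `i` on the other ones. -/
theorem contract {V : Tensor κ} (hV : Producible N κ V) {j k : κ} (hjk : j ≠ k) (p : ι → κ)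
    (hp : Function.Injective p) (hr : ∀ l, l ≠ j ∧ l ≠ k ↔ ∃ m, p m = l)
    (g : Fin 2 → (ι → Fin 2) → κ → Fin 2) (hg : ∀ a i l, g a i (p l) = i l)
    (hgj : ∀ a i, g a i j = a) (hgk : ∀ a i, g a i k = a) :
    Producible N ι fun i => ∑ a, V (g a i) := by
  let e : ι ≃ {l : κ // l ≠ j ∧ l ≠ k} :=
    Equiv.ofBijective (fun m => ⟨p m, (hr _).2 ⟨m, rfl⟩⟩)
      ⟨fun m m' h => hp (congrArg Subtype.val h), fun ⟨l, hl⟩ => by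
        obtain ⟨m, rfl⟩ := (hr l).1 hl
        exact ⟨m, rfl⟩⟩
  convert (hV.trace j k hjk).relabel e.symm using 1
  funext i
  simp only [Tensor.relabel, Tensor.trace, mul_ite, mul_one, mul_zero, Finset.sum_ite_eq,
    Finset.mem_univ, if_true]
  refine Finset.sum_congr rfl fun a _ => congrArg V ?_
  funext l
  by_cases h : l ≠ j ∧ l ≠ k
  · obtain ⟨m, rfl⟩ := (hr l).1 h
    have : e.symm ⟨p m, h⟩ = m := e.symm_apply_eq.2 rfl
    simp only [fillLegs, dif_pos h, this, hg]
  · simp only [fillLegs, dif_neg h, ite_self]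
    rcases not_and_or.1 h with h | h
    · rw [not_not.1 h, hgj]
    · rw [not_not.1 h, hgk]

/-- Identifying a leg with the leg `k₀`. -/
theorem merge {V : Tensor (Option κ)} (hV : Producible N (Option κ) V) (k₀ : κ) :
    Producible N κ fun i => V fun o => o.elim (i k₀) i := by
  classical
  -- Copy leg `none` with a repetition tensor; then trace one copy against `k₀` and let the other
  -- take over as leg `k₀`.
  have h₁ := (hV.prod (repetition (N := N))).contract (j := Sum.inl none) (k := Sum.inr 0)
    (by simp) (Sum.elim (fun k : κ => Sum.inl (some k)) fun m : Fin 2 => Sum.inr m.succ)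
    (by rintro (k | m) (k' | m') <;> simp)
    (by
      rintro ((_ | k) | m)
      · simp
      · simp
      · refine Fin.cases ?_ (fun m => ?_) m <;> simp)
    (fun a i => Sum.elim (fun o => o.elim a fun k => i (Sum.inl k))
      (Fin.cons a fun m => i (Sum.inr m)))
    (by rintro a i (k | m) <;> simp) (by simp) (by simp)
  have h₂ := h₁.contract (j := Sum.inl k₀) (k := Sum.inr 0) (by simp)
    (fun k : κ => if k = k₀ then Sum.inr 1 else Sum.inl k)
    (by
      intro k k'
      by_cases h : k = k₀ <;> by_cases h' : k' = k₀ <;> simp [h, h'])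
    (by
      rintro (k | m)
      · constructor
        · rintro ⟨h, -⟩
          have h : k ≠ k₀ := fun e => h (congrArg _ e)
          exact ⟨k, if_neg h⟩
        · rintro ⟨m, hm⟩
          by_cases h : m = k₀
          · simp [h] at hm
          · rw [if_neg h] at hm
            cases hm
            simpa using h
      · fin_cases m
        · simp only [Fin.zero_eta, ne_eq, not_true_eq_false, and_false, false_iff, not_exists]
          intro m
          by_cases h : m = k₀ <;> simp [h]
        · simp only [Fin.mk_one, ne_eq, reduceCtorEq, not_false_eq_true, Sum.inr.injEq,
            one_ne_zero, and_self, true_iff]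
          exact ⟨k₀, if_pos rfl⟩)
    (fun a i => Sum.elim (fun k => if k = k₀ then a else i k) ![a, i k₀])
    (by
      intro a i k
      by_cases h : k = k₀ <;> simp [h])
    (by simp) (by simp)
  convert h₂ using 1
  funext i
  have key : ∀ a b : Fin 2, XPLego.repetition (Fin.cons b ![a, i k₀]) =
      if a = i k₀ then (if b = a then 1 else 0) else 0 := by
    intro a b
    generalize i k₀ = c
    fin_cases a <;> fin_cases b <;> fin_cases c <;> simp [XPLego.repetition]
  rw [Finset.sum_eq_single (i k₀), Finset.sum_eq_single (i k₀)]
  · simp only [Tensor.prod, Sum.elim_inl, Sum.elim_inr]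
    erw [key]
    simp only [if_true, mul_one]
    congr 1
    funext o
    cases o with
    | none => rfl
    | some k => by_cases h : k = k₀ <;> simp [h]
  · intro b _ hb
    simp only [Tensor.prod, Sum.elim_inl, Sum.elim_inr]
    erw [key]
    simp [hb]
  · simp
  · intro b _ hb
    refine Finset.sum_eq_zero fun a _ => ?_
    simp only [Tensor.prod, Sum.elim_inl, Sum.elim_inr]
    erw [key]
    simp [hb]
  · simp

/-- Tracing two legs of the repetition tensor leaves the unnormalized `|0⟩ + |1⟩`; contracting with
it sums over a leg. -/
theorem one_unit : Producible N Unit fun _ => 1 := by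
  convert (repetition (N := N)).contract (j := 0) (k := 1) (by simp) (fun _ : Unit => 2)
    (fun _ _ _ => rfl) (by decide) (fun a i => ![a, a, i ()]) (by simp) (by simp) (by simp) using 1
  funext i
  generalize i () = b
  fin_cases b <;> simp [XPLego.repetition]

/-- Summing over a leg. -/
theorem sumOut {V : Tensor (Option ι)} (hV : Producible N (Option ι) V) :
    Producible N ι fun i => ∑ a, V fun o => o.elim a i := by
  convert (hV.prod (one_unit (N := N))).contract (j := Sum.inl none) (k := Sum.inr ()) (by simp)
    (fun i : ι => Sum.inl (some i)) (fun _ _ h => by simpa using h)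
    (by rintro ((_ | i) | _) <;> simp) (fun a i => Sum.elim (fun o => o.elim a i) fun _ => a)
    (by simp) (by simp) (by simp) using 1
  funext i
  simp [Tensor.prod]

theorem one_empty : Producible N Empty fun _ => 1 := by
  convert (ketZero.relabel (N := N)
    (Equiv.ofUnique (Fin 1) (Option Empty))).sumOut using 1
  funext i
  simp [Tensor.relabel, XPLego.ketZero, Subsingleton.elim (default : Option Empty) none]

theorem one [Finite ι] : Producible N ι fun _ => 1 := by
  induction ι using Finite.induction_empty_option with
  | of_equiv e h => exact h.relabel e
  | h_empty => exact (one_empty (N := N)).relabel (Equiv.equivOfIsEmpty Empty PEmpty)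
  | h_option h =>
    convert (h.prod one_unit).relabel (Equiv.optionEquivSumPUnit _).symm using 1
    funext i
    simp [Tensor.relabel, Tensor.prod]

theorem merge_all [Finite ι] (f : ι → κ) {V : Tensor (ι ⊕ κ)} (hV : Producible N (ι ⊕ κ) V) :
    Producible N κ fun i => V (Sum.elim (fun l => i (f l)) i) := by
  induction ι using Finite.induction_empty_option with
  | of_equiv e h =>
    convert h (f ∘ e) (hV.relabel (Equiv.sumCongr e.symm (Equiv.refl κ))) using 1
    funext i
    refine congrArg V ?_
    funext l
    cases l <;> simp
  | h_empty =>
    convert hV.relabel (Equiv.emptySum _ _) using 1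
    funext i
    refine congrArg V ?_
    funext l
    rcases l with l | l
    · exact l.elim
    · rfl
  | @h_option ι _ h =>
    let e : Option ι ⊕ κ ≃ Option (ι ⊕ κ) :=
      { toFun := Sum.elim (fun o => o.elim none fun l => some (Sum.inl l)) fun k =>
          some (Sum.inr k)
        invFun := fun o => o.elim (Sum.inl none)
          (Sum.elim (fun l => Sum.inl (some l)) Sum.inr)
        left_inv := by rintro ((_ | l) | k) <;> rfl
        right_inv := by rintro (_ | (l | k)) <;> rfl }
    convert h (fun l => f (some l)) ((hV.relabel e).merge (Sum.inr (f none))) using 1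
    funext i
    refine congrArg V ?_
    funext l
    rcases l with (_ | l) | k <;> rfl

/-- Legs can be identified, and legs on which nothing depends can be added. -/
theorem comap [Finite ι] [Finite κ] {V : Tensor ι} (hV : Producible N ι V) (f : ι → κ) :
    Producible N κ fun i => V fun l => i (f l) := by
  convert (hV.prod (one (N := N) (ι := κ))).merge_all f using 1
  funext i
  simp [Tensor.prod]

variable [Finite ι]

theorem mul {V W : Tensor ι} (hV : Producible N ι V) (hW : Producible N ι W) :
    Producible N ι fun i => V i * W i :=
  (hV.prod hW).comap (Sum.elim id id)

end Producible

/-- The tensors on the legs `ι` that can be produced, as a monoid under pointwise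
multiplication. -/
def producibleMonoid (N : ℕ) (ι : Type) [Finite ι] : Submonoid (Tensor ι) where
  carrier := {V | Producible N ι V}
  one_mem' := Producible.one
  mul_mem' := Producible.mul

namespace Producible

variable {N : ℕ} {ι : Type} [Finite ι]

theorem finset_prod {α : Type*} (s : Finset α) {V : α → Tensor ι}
    (h : ∀ x ∈ s, Producible N ι (V x)) : Producible N ι fun i => ∏ x ∈ s, V x i := by
  have h' : ∏ x ∈ s, V x ∈ producibleMonoid N ι := Submonoid.prod_mem _ h
  rwa [Finset.prod_fn] at h'

theorem pow {V : Tensor ι} (h : Producible N ι V) (k : ℕ) : Producible N ι fun i => V i ^ k :=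
  (producibleMonoid N ι).pow_mem h k

end Producible

/-! ### Characters of `ZMod 2` and Fourier inversion -/

theorem zmod_two_eq_zero_or_one (y : ZMod 2) : y = 0 ∨ y = 1 := by
  revert y
  decide

/-- The character `(-1) ^ (s * y)`. -/
def chr (s y : ZMod 2) : ℂ := if s = 0 then 1 else if y = 0 then 1 else -1

theorem chr_zero_left (y : ZMod 2) : chr 0 y = 1 := rfl

theorem chr_zero_right (s : ZMod 2) : chr s 0 = 1 := by simp [chr]

theorem chr_one_one : chr 1 1 = -1 := rfl

theorem chr_add (s x y : ZMod 2) : chr s (x + y) = chr s x * chr s y := by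
  have h : (1 + 1 : ZMod 2) = 0 := rfl
  rcases zmod_two_eq_zero_or_one s with rfl | rfl <;> rcases zmod_two_eq_zero_or_one x with rfl | rfl <;>
    rcases zmod_two_eq_zero_or_one y with rfl | rfl <;>
    simp [chr_zero_left, chr_zero_right, chr_one_one, h]

theorem chr_sum {α : Type*} (s : ZMod 2) (t : Finset α) (f : α → ZMod 2) :
    chr s (∑ x ∈ t, f x) = ∏ x ∈ t, chr s (f x) := by
  classical
  induction t using Finset.induction_on with
  | empty => simp [chr_zero_right]
  | insert a t ha h => rw [Finset.sum_insert ha, Finset.prod_insert ha, chr_add, h]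

theorem sum_zmod_two (F : ZMod 2 → ℂ) : ∑ s, F s = F 0 + F 1 := Fin.sum_univ_two F

/-- Fourier inversion on `ZMod 2`. -/
theorem eq_sum_chr (φ : ZMod 2 → ℂ) (y : ZMod 2) :
    φ y = ∑ s, 1 / 2 * ((∑ t, φ t * chr s t) * chr s y) := by
  simp only [sum_zmod_two]
  rcases zmod_two_eq_zero_or_one y with rfl | rfl <;>
    simp only [chr_zero_left, chr_zero_right, chr_one_one] <;> ring

theorem hadamard_apply (i j : ZMod 2) :
    hadamard i j = ((Real.sqrt 2 : ℝ) : ℂ)⁻¹ * chr i j := by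
  rcases zmod_two_eq_zero_or_one i with rfl | rfl <;> rcases zmod_two_eq_zero_or_one j with rfl | rfl <;>
    simp only [chr_zero_left, chr_zero_right, chr_one_one] <;>
    simp only [hadamard] <;> rfl

theorem sqrt_two_ne_zero : ((Real.sqrt 2 : ℝ) : ℂ) ≠ 0 := by simp

theorem sqrt_two_sq : ((Real.sqrt 2 : ℝ) : ℂ) ^ 2 = 2 := by
  rw [← Complex.ofReal_pow, Real.sq_sqrt (by norm_num)]
  norm_num

/-! ### Scalars and affine substitution -/

namespace Producible

variable {N : ℕ} {ι : Type}

/-- `ZMod 2` unfolds to `Fin 2`, so a function on `ι → ZMod 2` is a tensor; this form makes linear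
algebra over `ZMod 2` available. -/
theorem of_eq {V W : (ι → ZMod 2) → ℂ} (hV : Producible N ι V) (h : ∀ v, W v = V v) :
    Producible N ι W :=
  (funext h : W = V) ▸ hV

variable [Finite ι]

/-- This scalar is `⟨0|H|0⟩`; summing it over an idle leg doubles it to `√2`, so that normalizations
can be corrected exactly. -/
theorem inv_sqrt_two : Producible N ι fun _ => ((Real.sqrt 2 : ℝ) : ℂ)⁻¹ := by
  have hk : ∀ i : Option (Option ι), Producible N (Option (Option ι)) fun v =>
      if v i = 0 then 1 else 0 := fun i => ketZero.comap fun _ => i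
  have hh : Producible N (Option (Option ι)) fun v => XPLego.hadamard (v none) (v (some none)) :=
    hadamard.comap (N := N) ![(none : Option (Option ι)), some none]
  convert ((hh.mul ((hk none).mul (hk (some none)))).sumOut).sumOut using 1
  funext i
  simp [XPLego.hadamard]

theorem sqrt_two : Producible N ι fun _ => ((Real.sqrt 2 : ℝ) : ℂ) := by
  convert ((inv_sqrt_two (N := N) (ι := Option ι))).sumOut using 1
  funext i
  simp only [Finset.sum_const, Finset.card_univ, Fintype.card_fin, nsmul_eq_mul]
  rw [eq_mul_inv_iff_mul_eq₀ sqrt_two_ne_zero, ← pow_two, sqrt_two_sq]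
  norm_num

theorem chr (i j : ι) : Producible N ι fun v : ι → ZMod 2 => XPLego.chr (v i) (v j) := by
  refine ((hadamard.comap (N := N) ![i, j]).mul sqrt_two).of_eq fun v => ?_
  change _ = XPLego.hadamard (v i) (v j) * _
  rw [hadamard_apply, mul_right_comm, inv_mul_cancel₀ sqrt_two_ne_zero, one_mul]

/-- Composing a producible one-leg tensor with an affine function of the legs. -/
theorem comp_affine {φ : ZMod 2 → ℂ}
    (hφ : Producible N Unit fun x : Unit → ZMod 2 => φ (x ()))
    (χ : (ι → ZMod 2) →ᵃ[ZMod 2] ZMod 2) :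
    Producible N ι fun v : ι → ZMod 2 => φ (χ v) := by
  classical
  have := Fintype.ofFinite ι
  -- The Fourier transform of `φ`, still a one-leg tensor.
  have hφ' : Producible N Unit fun x : Unit → ZMod 2 =>
      ∑ t : ZMod 2, φ t * XPLego.chr (x ()) t :=
    ((hφ.comap fun _ => (none : Option Unit)).mul (chr (some ()) none)).sumOut
  have hc : ∀ c : ZMod 2, Producible N Unit fun x : Unit → ZMod 2 => XPLego.chr (x ()) c := by
    intro c
    rcases zmod_two_eq_zero_or_one c with rfl | rfl
    · exact one.of_eq fun x => chr_zero_right _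
    · refine (chr () ()).of_eq fun x => ?_
      rcases zmod_two_eq_zero_or_one (x ()) with h | h <;> rw [h] <;> rfl
  have hj : ∀ (c : ZMod 2) (j : ι), Producible N (Option ι) fun x : Option ι → ZMod 2 =>
      XPLego.chr (x none) (x (some j) * c) := by
    intro c j
    rcases zmod_two_eq_zero_or_one c with rfl | rfl
    · exact one.of_eq fun x => by rw [mul_zero, chr_zero_right]
    · exact (chr none (some j)).of_eq fun x => by rw [mul_one]
  -- The summed leg `none` carries the frequency `s`. The character of `χ v` splits into a constant
  -- factor and one factor per leg, and `(1/√2)²` is the `1/2` of Fourier inversion.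
  have hT := (((inv_sqrt_two (N := N) (ι := Option ι)).pow 2).mul
    ((hφ'.comap fun _ => none).mul (((hc (χ 0)).comap fun _ => none).mul
      (finset_prod Finset.univ fun j _ => hj (χ.linear (Pi.single j 1)) j)))).sumOut
  refine hT.of_eq fun v => ?_
  have hχ : χ v = χ 0 + ∑ j, v j * χ.linear (Pi.single j 1) := by
    have h1 := congrFun (AffineMap.decomp χ) v
    have h2 := LinearMap.pi_apply_eq_sum_univ χ.linear v
    simp only [Pi.add_apply] at h1
    rw [h1, h2, add_comm]
    congr 1
    refine Finset.sum_congr rfl fun j _ => ?_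
    rw [smul_eq_mul]
    congr 2
    funext k
    simp [Pi.single_apply, eq_comm]
  rw [eq_sum_chr φ, inv_pow, sqrt_two_sq, ← one_div]
  refine Finset.sum_congr rfl fun s _ => ?_
  rw [hχ, chr_add, chr_sum]
  rfl

end Producible

/-! ### Phases -/

theorem omega_ne_zero (N : ℕ) : omega N ≠ 0 := Complex.exp_ne_zero _

theorem star_omega (N : ℕ) : star (omega N) = (omega N)⁻¹ :=
  eq_inv_of_mul_eq_one_left (star_omega_mul N)

theorem norm_omega (N : ℕ) : ‖omega N‖ = 1 := by
  have h : omega N = Complex.exp ((Real.pi / N : ℝ) * Complex.I) := by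
    rw [omega]
    congr 1
    push_cast
    ring
  rw [h, Complex.norm_exp_ofReal_mul_I]

theorem omega_pow (N : ℕ) (hN : N ≠ 0) : omega N ^ (2 * N) = 1 := by
  rw [omega, ← Complex.exp_nat_mul, ← Complex.exp_two_pi_mul_I]
  congr 1
  have : (N : ℂ) ≠ 0 := Nat.cast_ne_zero.2 hN
  push_cast
  field_simp

theorem exists_pow_eq_zpow (N : ℕ) (hN : N ≠ 0) (z : ℤ) : ∃ k : ℕ, omega N ^ z = omega N ^ k := by
  refine ⟨(z % (2 * N : ℕ)).toNat, ?_⟩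
  have h0 : ((2 * N : ℕ) : ℤ) ≠ 0 := by
    have : 2 * N ≠ 0 := by omega
    exact_mod_cast this
  rw [← zpow_natCast, Int.toNat_of_nonneg (Int.emod_nonneg _ h0)]
  conv_lhs => rw [← Int.emod_add_mul_ediv z (2 * N : ℕ)]
  rw [zpow_add₀ (omega_ne_zero N), _root_.zpow_mul, zpow_natCast, omega_pow N hN, _root_.one_zpow, mul_one]

/-- The monoid of functions generated by the powers of `ω ^ χ`, for the affine functions `χ`. -/
def phaseMonoid (N : ℕ) (ι : Type) : Submonoid ((ι → ZMod 2) → ℂ) :=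
  Submonoid.closure {f | ∃ (χ : (ι → ZMod 2) →ᵃ[ZMod 2] ZMod 2) (z : ℤ),
    f = fun v => omega N ^ (z * (χ v).val)}

section phaseMonoid

variable {N : ℕ} {ι : Type}

theorem omega_zpow_mem (χ : (ι → ZMod 2) →ᵃ[ZMod 2] ZMod 2) (z : ℤ) :
    (fun v => omega N ^ (z * (χ v).val)) ∈ phaseMonoid N ι :=
  Submonoid.subset_closure ⟨χ, z, rfl⟩

/-- Adding two bits as integers exceeds their sum mod 2 by twice the carry `x y`. -/
theorem two_mul_val_mul_val (x y : ZMod 2) :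
    2 * (x.val * y.val : ℤ) = x.val + y.val + -1 * (x + y).val := by
  revert x y
  decide

theorem omega_zpow_two_mul_mem (χ χ' : (ι → ZMod 2) →ᵃ[ZMod 2] ZMod 2) (z : ℤ) :
    (fun v => omega N ^ (2 * z * ((χ v).val * (χ' v).val))) ∈ phaseMonoid N ι := by
  have h := mul_mem (mul_mem (omega_zpow_mem (N := N) χ z) (omega_zpow_mem χ' z))
    (omega_zpow_mem (χ + χ') (-z))
  convert h using 1
  funext v
  have h2 := two_mul_val_mul_val (χ v) (χ' v)
  simp only [Pi.mul_apply]
  rw [← zpow_add₀ (omega_ne_zero N), ← zpow_add₀ (omega_ne_zero N)]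
  congr 1
  have h3 : (χ + χ') v = χ v + χ' v := rfl
  rw [h3]
  linear_combination z * h2

theorem comp_mem_phaseMonoid {f : (ι → ZMod 2) → ℂ} (hf : f ∈ phaseMonoid N ι)
    (T : (ι → ZMod 2) →ᵃ[ZMod 2] (ι → ZMod 2)) : (fun v => f (T v)) ∈ phaseMonoid N ι := by
  induction hf using Submonoid.closure_induction with
  | mem f hf =>
    obtain ⟨χ, z, rfl⟩ := hf
    exact omega_zpow_mem (χ.comp T) z
  | one => exact one_mem _
  | mul f g _ _ hf hg => exact mul_mem hf hg

theorem norm_of_mem_phaseMonoid {f : (ι → ZMod 2) → ℂ} (hf : f ∈ phaseMonoid N ι)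
    (v : ι → ZMod 2) : ‖f v‖ = 1 := by
  induction hf using Submonoid.closure_induction with
  | mem f hf =>
    obtain ⟨χ, z, rfl⟩ := hf
    rw [norm_zpow, norm_omega, _root_.one_zpow]
  | one => simp
  | mul f g _ _ hf hg => rw [Pi.mul_apply, norm_mul, hf, hg, one_mul]

theorem Producible.of_mem_phaseMonoid [Finite ι] (hN : N ≠ 0) {f : (ι → ZMod 2) → ℂ}
    (hf : f ∈ phaseMonoid N ι) : Producible N ι f := by
  induction hf using Submonoid.closure_induction with
  | mem f hf =>
    obtain ⟨χ, z, rfl⟩ := hf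
    obtain ⟨k, hk⟩ := exists_pow_eq_zpow N hN z
    have hp : Producible N Unit fun x : Unit → ZMod 2 => omega N ^ (x ()).val := by
      refine ((Producible.phase (N := N)).comap fun _ => ()).of_eq fun x => ?_
      rcases zmod_two_eq_zero_or_one (x ()) with h | h
      · rw [h]
        exact pow_zero _
      · rw [h]
        exact pow_one _
    refine ((hp.pow k).comp_affine (φ := fun y => (omega N ^ y.val) ^ k) χ).of_eq fun v => ?_
    rw [_root_.zpow_mul, hk, zpow_natCast, pow_right_comm]
  | one => exact Producible.one
  | mul f g _ _ hf hg => exact hf.mul hg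

/-- A vector that is multiplied by phases when it is shifted by the elements of `s` is given on
the cosets of their span by an element of the phase monoid. -/
theorem exists_phase [Fintype ι] {ψ : (ι → ZMod 2) → ℂ} (a : ι → ZMod 2)
    (s : Finset (ι → ZMod 2))
    (hs : ∀ x ∈ s, ∃ p z : ι → ℤ, ∀ v,
      ψ (v + x) = (∏ i, omega N ^ (p i + 2 * z i * (v i).val)) * ψ v) :
    ∃ f ∈ phaseMonoid N ι, ∀ x ∈ Submodule.span (ZMod 2) (s : Set (ι → ZMod 2)),
      ψ (a + x) = f (a + x) * ψ a := by
  classical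
  induction s using Finset.induction_on with
  | empty => exact ⟨1, one_mem _, by simp⟩
  | insert x s _ ih =>
    obtain ⟨f, hf, hfx⟩ := ih fun y hy => hs y (Finset.mem_insert_of_mem hy)
    obtain ⟨p, z, hx⟩ := hs x (Finset.mem_insert_self _ _)
    by_cases hxs : x ∈ Submodule.span (ZMod 2) (s : Set (ι → ZMod 2))
    · refine ⟨f, hf, ?_⟩
      rwa [Finset.coe_insert, Submodule.span_insert_eq_span hxs]
    -- The functional `u` vanishes on the old span and is `1` at the new generator, so `u'` reads
    -- off the coefficient of `x` in `v - a`, and `T` removes that component, projecting back to `a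
    -- + span s`.
    obtain ⟨u, hux, hu⟩ := Submodule.exists_le_ker_of_notMem hxs
    replace hux : u x = 1 := (zmod_two_eq_zero_or_one _).resolve_left hux
    let u' : (ι → ZMod 2) →ᵃ[ZMod 2] ZMod 2 := u.toAffineMap - AffineMap.const _ _ (u a)
    let T : (ι → ZMod 2) →ᵃ[ZMod 2] (ι → ZMod 2) :=
      AffineMap.id _ _ + (LinearMap.toSpanSingleton (ZMod 2) _ x).toAffineMap.comp u'
    let c (i : ι) : (ι → ZMod 2) →ᵃ[ZMod 2] ZMod 2 :=
      (LinearMap.proj (R := ZMod 2) (φ := fun _ : ι => ZMod 2) i).toAffineMap.comp T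
    -- The shift by `x` is applied at `T v` exactly when `u' v = 1`, so its exponent is multiplied
    -- by `u' v`; the resulting product of bits keeps the factor `2`.
    refine ⟨(fun v => f (T v)) * ∏ i, ((fun v => omega N ^ (p i * (u' v).val)) *
      fun v => omega N ^ (2 * z i * ((u' v).val * (c i v).val))),
      mul_mem (comp_mem_phaseMonoid hf T) (Submonoid.prod_mem _ fun i _ =>
        mul_mem (omega_zpow_mem _ _) (omega_zpow_two_mul_mem _ _ _)), ?_⟩
    intro y hy
    rw [Finset.coe_insert, Submodule.mem_span_insert] at hy
    obtain ⟨e, w, hw, rfl⟩ := hy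
    have hu' : u' (a + (e • x + w)) = e := by
      have : u w = 0 := hu hw
      simp [u', hux, this]
    have hT : T (a + (e • x + w)) = a + w := by
      have h : T (a + (e • x + w)) = a + (e • x + w) + u' (a + (e • x + w)) • x := rfl
      have he : e • x + e • x = 0 := by
        rw [← add_smul, CharTwo.add_self_eq_zero, zero_smul]
      rw [h, hu', add_assoc, add_right_comm, he, zero_add]
    have hc (i : ι) : c i (a + (e • x + w)) = (a + w) i := by rw [← hT]; rfl
    simp only [Pi.mul_apply, Finset.prod_apply, hu', hT, hc]
    rcases zmod_two_eq_zero_or_one e with rfl | rfl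
    · simp [hfx w hw]
    · have : a + ((1 : ZMod 2) • x + w) = a + w + x := by rw [one_smul]; abel
      rw [this, hx, hfx w hw, ← mul_assoc, mul_comm (f _)]
      congr 2
      refine Finset.prod_congr rfl fun i _ => ?_
      rw [← zpow_add₀ (omega_ne_zero N)]
      congr 1
      have h1 : ((1 : ZMod 2).val : ℤ) = 1 := rfl
      rw [h1]
      ring

end phaseMonoid

/-! ### Elements of the XP group -/

theorem exists_of_mem_xpGroupOne {N : ℕ} {A : unitaryGroup (Fin 2) ℂ} (hA : A ∈ xpGroupOne N) :
    ∃ (x : ZMod 2) (p z : ℤ), ∀ a b : ZMod 2, (A : Matrix (Fin 2) (Fin 2) ℂ) a b =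
      if a = b + x then omega N ^ (p + 2 * z * b.val) else 0 := by
  have h0 := omega_ne_zero N
  have hv1 : ((1 : ZMod 2).val : ℤ) = 1 := rfl
  have h11 : (1 + 1 : ZMod 2) = 0 := rfl
  have h01 : (0 : ZMod 2) ≠ 1 := by decide
  induction hA using Subgroup.closure_induction with
  | mem A hA =>
    rcases hA with rfl | rfl | rfl
    · refine ⟨0, 1, 0, fun a b => ?_⟩
      change omega N * (1 : Matrix (ZMod 2) (ZMod 2) ℂ) a b = _
      simp [Matrix.one_apply]
    · refine ⟨1, 0, 0, fun a b => ?_⟩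
      rcases zmod_two_eq_zero_or_one a with rfl | rfl <;>
        rcases zmod_two_eq_zero_or_one b with rfl | rfl <;> simp [h11, h01] <;> rfl
    · refine ⟨0, 0, 1, fun a b => ?_⟩
      rcases zmod_two_eq_zero_or_one a with rfl | rfl <;>
        rcases zmod_two_eq_zero_or_one b with rfl | rfl <;> simp [h01, hv1] <;> rfl
  | one =>
    refine ⟨0, 0, 0, fun a b => ?_⟩
    change (1 : Matrix (ZMod 2) (ZMod 2) ℂ) a b = _
    simp [Matrix.one_apply]
  | mul A B _ _ hA hB =>
    obtain ⟨x, p, z, hA⟩ := hA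
    obtain ⟨x', p', z', hB⟩ := hB
    have hAB : ∀ a b : ZMod 2, ((A * B : unitaryGroup (Fin 2) ℂ) : Matrix (Fin 2) (Fin 2) ℂ) a b =
        ∑ c : ZMod 2, (A : Matrix (Fin 2) (Fin 2) ℂ) a c * (B : Matrix (Fin 2) (Fin 2) ℂ) c b :=
      fun a b => Matrix.mul_apply
    -- The phase of `A` is read at `b + x'`; for `x' = 1` that bit is `1 - b`, which flips the sign
    -- of `z` and adds `2 * z` to the constant.
    refine ⟨x + x', p + p' + 2 * z * x'.val, if x' = 0 then z + z' else z' - z, fun a b => ?_⟩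
    rw [hAB]
    simp only [hA, hB]
    rw [Finset.sum_eq_single (b + x') (fun c _ hc => by rw [if_neg hc, mul_zero]) (by simp),
      if_pos rfl, ite_mul, zero_mul, ← zpow_add₀ h0]
    have : a = b + x' + x ↔ a = b + (x + x') := by rw [add_comm x, add_assoc]
    simp only [this]
    congr 2
    rcases zmod_two_eq_zero_or_one x' with rfl | rfl <;>
      rcases zmod_two_eq_zero_or_one b with rfl | rfl <;> simp [h11, hv1] <;> ring
  | inv A _ hA =>
    obtain ⟨x, p, z, hA⟩ := hA
    refine ⟨x, -p - 2 * z * x.val, (2 * x.val - 1) * z, fun a b => ?_⟩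
    change star ((A : Matrix (Fin 2) (Fin 2) ℂ) b a) = _
    rw [hA]
    have : b = a + x ↔ a = b + x := by
      constructor <;> rintro rfl <;> rw [add_assoc, CharTwo.add_self_eq_zero, add_zero]
    simp only [this]
    by_cases h : a = b + x
    · rw [if_pos h, if_pos h]
      subst h
      rw [star_zpow₀, star_omega, _root_.inv_zpow']
      congr 1
      rcases zmod_two_eq_zero_or_one x with rfl | rfl <;>
        rcases zmod_two_eq_zero_or_one b with rfl | rfl <;> simp [h11, hv1] <;> ring
    · rw [if_neg h, if_neg h, star_zero]

/-- With the image named `φ`, the same formula serves for `ψ` itself, taking `φ = ψ`, and for its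
truncation, whose image is not yet known. -/
theorem exists_of_mem_xpGroup {N n : ℕ} {g : unitaryGroup (Fin n → Fin 2) ℂ}
    (hg : g ∈ xpGroup N n) :
    ∃ (x : Fin n → ZMod 2) (p z : Fin n → ℤ), ∀ ψ φ : (Fin n → ZMod 2) → ℂ,
      (g : Matrix (Fin n → Fin 2) (Fin n → Fin 2) ℂ) *ᵥ ψ = φ → ∀ v, φ (v + x) =
        (∏ i, omega N ^ (p i + 2 * z i * (v i).val)) * ψ v := by
  obtain ⟨A, hA, rfl⟩ := hg
  choose x p z h using fun i => exists_of_mem_xpGroupOne (hA i (Set.mem_univ i))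
  refine ⟨x, p, z, ?_⟩
  rintro ψ _ rfl v
  change ∑ b : Fin n → ZMod 2,
    (∏ i, (A i : Matrix (Fin 2) (Fin 2) ℂ) ((v + x) i) (b i)) * ψ b = _
  rw [Finset.sum_eq_single v]
  · congr 1
    refine Finset.prod_congr rfl fun i _ => ?_
    rw [h]
    exact if_pos rfl
  · intro b _ hb
    obtain ⟨i, hi⟩ := Function.ne_iff.1 hb
    rw [Finset.prod_eq_zero (Finset.mem_univ i), zero_mul]
    rw [h, if_neg]
    exact fun e => hi (add_right_cancel e).symm
  · simp

/-! ### XP stabilizer states -/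

theorem IsXPState.exists_eq {N n : ℕ} {ψ : (Fin n → ZMod 2) → ℂ} (hψ : IsXPState N ψ) :
    ∃ (L : Submodule (ZMod 2) (Fin n → ZMod 2)) (a : Fin n → ZMod 2),
      ∃ f ∈ phaseMonoid N (Fin n), (∀ v, v - a ∈ L → ψ v = f v * ψ a) ∧
        ∀ v, v - a ∉ L → ψ v = 0 := by
  classical
  obtain ⟨hnorm, S, hS, hcode⟩ := hψ
  have hψS : ψ ∈ codespace S := hcode ▸ Submodule.mem_span_singleton_self ψ
  obtain ⟨a, ha⟩ : ∃ a, ψ a ≠ 0 := by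
    by_contra! h
    have h0 : ∀ e : Fin n → Fin 2, ψ e = 0 := h
    simp [h0] at hnorm
  let s : Finset (Fin n → ZMod 2) := {x | ∃ g ∈ S, ∃ p z : Fin n → ℤ,
    ∀ ψ φ : (Fin n → ZMod 2) → ℂ,
      (g : Matrix (Fin n → Fin 2) (Fin n → Fin 2) ℂ) *ᵥ ψ = φ → ∀ v, φ (v + x) =
        (∏ i, omega N ^ (p i + 2 * z i * (v i).val)) * ψ v}
  obtain ⟨f, hf, hfa⟩ := exists_phase (N := N) (ψ := ψ) a s fun x hx => by
    obtain ⟨g, hg, p, z, h⟩ := (Finset.mem_filter.1 hx).2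
    exact ⟨p, z, h ψ ψ (hψS g hg)⟩
  set L := Submodule.span (ZMod 2) (s : Set (Fin n → ZMod 2))
  refine ⟨L, a, f, hf, fun v hv => ?_, fun v hv => ?_⟩
  · have := hfa _ hv
    rwa [add_sub_cancel] at this
  -- The truncation to `a + L` is still fixed, as the shifts preserve that coset. Hence it is a
  -- multiple of `ψ`, and comparing values at `a` shows that the multiple is `1`.
  · let χ : (Fin n → ZMod 2) → ℂ := fun v => if v - a ∈ L then ψ v else 0
    have hχ : χ ∈ codespace S := by
      intro g hg
      obtain ⟨x, p, z, h⟩ := exists_of_mem_xpGroup (hS hg)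
      have hx : x ∈ L := Submodule.subset_span
        (Finset.mem_coe.2 (Finset.mem_filter.2 ⟨Finset.mem_univ _, g, hg, p, z, h⟩))
      funext w
      obtain ⟨v, rfl⟩ : ∃ v : Fin n → ZMod 2, w = v + x :=
        ⟨_, (sub_add_cancel (G := Fin n → ZMod 2) w x).symm⟩
      refine (h χ _ rfl v).trans ?_
      have h1 := h ψ ψ (hψS g hg) v
      have h2 : v + x - a ∈ L ↔ v - a ∈ L := by
        rw [add_sub_right_comm]
        exact L.add_mem_iff_left hx
      simp only [χ, h2, h1]
      split_ifs <;> simp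
    rw [hcode] at hχ
    obtain ⟨c, hc⟩ :=
      (Submodule.mem_span_singleton (R := ℂ) (M := (Fin n → Fin 2) → ℂ) (x := χ) (y := ψ)).1 hχ
    have hca : c * ψ a = ψ a := by
      refine (congrFun hc a).trans ?_
      simp [χ]
    have hc1 : c = 1 := mul_right_cancel₀ ha (hca.trans (one_mul _).symm)
    have h1 : c * ψ v = χ v := congrFun hc v
    rw [hc1, one_mul] at h1
    simp only [h1, χ, if_neg hv]

/-- The indicator function of an affine subspace is producible. -/
theorem Producible.indicator {N : ℕ} {ι : Type} [Finite ι]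
    (L : Submodule (ZMod 2) (ι → ZMod 2)) (a : ι → ZMod 2) [DecidablePred fun v => v - a ∈ L] :
    Producible N ι fun v : ι → ZMod 2 => if v - a ∈ L then (1 : ℂ) else 0 := by
  classical
  have : Finite (Module.Dual (ZMod 2) (ι → ZMod 2)) := DFunLike.finite _
  have := Fintype.ofFinite (Module.Dual (ZMod 2) (ι → ZMod 2))
  have hk : Producible N Unit fun x : Unit → ZMod 2 => if x () = 0 then (1 : ℂ) else 0 :=
    Producible.ketZero.comap fun _ => ()
  -- `L` is the common kernel of its annihilator; each parity check `u (v - a) = 0` is `|0⟩`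
  -- composed with an affine function.
  refine (Producible.finset_prod (N := N)
    (Finset.univ.filter fun u : Module.Dual (ZMod 2) (ι → ZMod 2) => u ∈ L.dualAnnihilator)
    fun u _ => hk.comp_affine (φ := fun y => if y = 0 then (1 : ℂ) else 0)
      (u.toAffineMap - AffineMap.const _ _ (u a))).of_eq fun v => ?_
  have h := Subspace.forall_mem_dualAnnihilator_apply_eq_zero_iff L (v - a)
  have hu (u : Module.Dual (ZMod 2) (ι → ZMod 2)) :
      (u.toAffineMap - AffineMap.const (ZMod 2) (ι → ZMod 2) (u a)) v = u (v - a) :=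
    (map_sub u v a).symm
  simp only [hu, Finset.prod_ite_zero, Finset.prod_const_one, Finset.mem_filter,
    Finset.mem_univ, true_and, h]

/-- The `2 ^ finrank L` equal squared moduli on the coset add up to `1`. -/
theorem norm_of_isXPState {n : ℕ} {ψ : (Fin n → ZMod 2) → ℂ} (hψ : ∑ v, ‖ψ v‖ ^ 2 = 1)
    (L : Submodule (ZMod 2) (Fin n → ZMod 2)) (a : Fin n → ZMod 2)
    (h : ∀ v, v - a ∈ L → ‖ψ v‖ = ‖ψ a‖) (h' : ∀ v, v - a ∉ L → ψ v = 0) :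
    ‖ψ a‖ = (Real.sqrt 2)⁻¹ ^ Module.finrank (ZMod 2) L := by
  classical
  have hsum : ∑ v, ‖ψ v‖ ^ 2 = ∑ v : Fin n → ZMod 2, if v ∈ L then ‖ψ a‖ ^ 2 else 0 := by
    refine Fintype.sum_equiv (Equiv.subRight a) _ _ fun v => ?_
    simp only [Equiv.subRight_apply]
    split_ifs with hv
    · rw [h v hv]
    · simp [h' v hv]
  have hcard : Fintype.card L = 2 ^ Module.finrank (ZMod 2) L := by
    rw [Module.card_eq_pow_finrank (K := ZMod 2), ZMod.card]
  rw [hψ, ← Finset.sum_filter, Finset.sum_const, ← Fintype.card_subtype, nsmul_eq_mul] at hsum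
  erw [hcard] at hsum
  rw [← sq_eq_sq₀ (norm_nonneg _) (by positivity), ← pow_mul, mul_comm _ 2, pow_mul, inv_pow,
    Real.sq_sqrt (by norm_num), inv_pow]
  push_cast at hsum
  exact (inv_eq_of_mul_eq_one_right hsum.symm).symm

end XPLego

theorem mainTheorem4 (N : ℕ) (hN : 2 ≤ N) (n : ℕ) (ψ : (Fin n → Fin 2) → ℂ)
    (hψ : XPLego.IsXPState N ψ) :
    ∃ c : ℂ, ‖c‖ = 1 ∧ XPLego.Producible N (Fin n) (c • ψ) := by
  classical
  obtain ⟨L, a, f, hf, hL, hL'⟩ := XPLego.IsXPState.exists_eq hψ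
  have hN0 : N ≠ 0 := by omega
  have hnorm := XPLego.norm_of_isXPState hψ.1 L a
    (fun v hv => by rw [hL v hv, norm_mul, XPLego.norm_of_mem_phaseMonoid hf, one_mul]) hL'
  have ha : ψ a ≠ 0 := by
    intro h
    rw [h, norm_zero] at hnorm
    exact (pow_pos (inv_pos.2 (Real.sqrt_pos.2 two_pos)) _).ne hnorm
  have hna : (‖ψ a‖ : ℂ) ≠ 0 := by simpa using ha
  -- This phase makes the amplitude at `a` positive, hence exactly a power of `1/√2`.
  refine ⟨‖ψ a‖ / ψ a, by simp [ha], ?_⟩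
  refine ((XPLego.Producible.inv_sqrt_two.pow (Module.finrank (ZMod 2) L)).mul
    ((XPLego.Producible.indicator L a).mul
      (XPLego.Producible.of_mem_phaseMonoid hN0 hf))).of_eq fun v => ?_
  have hc : ((Real.sqrt 2 : ℝ) : ℂ)⁻¹ ^ Module.finrank (ZMod 2) L = ‖ψ a‖ := by
    rw [hnorm]
    push_cast
    rfl
  change ‖ψ a‖ / ψ a * ψ v = _
  rw [hc]
  by_cases hv : v - a ∈ L
  · rw [if_pos hv, one_mul, hL v hv]
    field_simp
  · rw [if_neg hv, hL' v hv]
    ring
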